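/- A place of a field is an equivalence class of nontrivial real absolute values, and for an extension $L/K$ the notation $w\mid v$ means that the place $w$ of $L$ restricts to the place $v$ of $K$. A place $v$ of $K$ is well behaved if $\sum_{w\mid v}[L_w:K_v]=[L:K]$ for every finite extension $L/K$, where $L_w$, $K_v$ are the completions. Let $K$ be a field with a proper set of absolute values $\{\|\cdot\|_v : v\in\mathcal M_K\}$: $\mathcal M_K$ is a set of places of $K$, each $\|\cdot\|_v$ is an absolute value in the place $v$, each $v\in\mathcal M_K$ is well behaved, and for every $\alpha\in K^\times$ one has $\|\alpha\|_v\neq 1$ for only finitely many $v\in\mathcal M_K$ and $\prod_{v\in\mathcal M_K}\|\alpha\|_v=1$. Let $N/K$ be a (possibly infinite) Galois extension and let $G=\mathrm{Aut}(N/K)$ with its Krull topology and its Haar measure $\mu$, normalized by $\mu(G)=1$. For $v\in\mathcal M_K$ let $Y(K,v)$ be the set of places $y$ of $N$ with $y\mid v$, with the inverse limit topology of the finite discrete sets $W_v(L/K)$ of places of $L$ above $v$, where $L/K$ runs over the finite Galois subextensions of $N/K$. Let $G$ act on $Y(K,v)$ by $\|\alpha\|_{\tau y}=\|\tau^{-1}\alpha\|_y$,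 and let $Y=\bigsqcup_{v\in\mathcal M_K}Y(K,v)$ be the topological disjoint union. Then each $Y(K,v)$ is nonempty. For $F\in C_c(Y)$ (real valued, continuous, compactly supported) put $$I(F)=\sum_{v\in\mathcal M_K}\int_G F(\tau z_v)\,d\mu(\tau),\qquad z_v\in Y(K,v),$$ which does not depend on the choice of the points $z_v$. There exist a $\sigma$-algebra $\mathcal Y$ of subsets of $Y$ containing the Borel sets, and a unique regular measure $\lambda$ on $\mathcal Y$ (that is, finite on compact sets, outer regular on all sets of $\mathcal Y$, and inner regular, with respect to compact sets, on open sets), such that $I(F)=\int_Y F\,d\lambda$ for all $F\in C_c(Y)$. Moreover: (i) if $\eta\in G$ and $F\in L^1(Y,\mathcal Y,\lambda)$, then $y\mapsto F(\eta y)$ is in $L^1(Y,\mathcal Y,\lambda)$ and $\int_{Y(K,v)}F(\eta y)\,d\lambda(y)=\int_{Y(K,v)}F(y)\,d\lambda(y)$ for every $v\in\mathcal M_K$; (ii) $\lambda(E)=\inf\{\lambda(U): E\subseteq U\subseteq Y,\ U\text{ open}\}$ for every $E\in\mathcal Y$; (iii) $\lambda(E)=\sup\{\lambda(V): V\subseteq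 E,\ V\text{ compact}\}$ for every $E\in\mathcal Y$ that meets $Y(K,v)$ for only countably many $v\in\mathcal M_K$; in particular for every $E\in\mathcal Y$ if $\mathcal M_K$ is countable; (iv) if $E\in\mathcal Y$ and $\lambda(E)=0$, then every subset of $E$ is in $\mathcal Y$. -/

import Mathlib

open MeasureTheory
open scoped CompactlySupported

universe u w

noncomputable section

/-- Equivalence of nontrivial real absolute values on a field
(`a ~ b` iff `b = a ^ c` for some `c > 0`). -/
def placeSetoid (K : Type*) [Field K] : Setoid {a : AbsoluteValue K ℝ // a.IsNontrivial} where
  r a b := a.1.IsEquiv b.1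
  iseqv := ⟨fun _ => .rfl, fun h => h.symm, fun h h' => h.trans h'⟩

/-- A place of a field: an equivalence class of nontrivial real absolute values. -/
def Place (K : Type*) [Field K] : Type _ := Quotient (placeSetoid K)

namespace Place

/-- The absolute value `a` belongs to the place `v` (in particular `a` is nontrivial). -/
def Contains {K : Type*} [Field K] (v : Place K) (a : AbsoluteValue K ℝ) : Prop :=
  ∃ h : a.IsNontrivial, (Quotient.mk (placeSetoid K) ⟨a, h⟩ : Place K) = v

/-- `w ∣ v`: some absolute value in the place `w` of `L` restricts on `K` to an absolute value
in the place `v` of `K`. -/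
def LiesOver {K L : Type*} [Field K] [Field L] [Algebra K L] (w : Place L) (v : Place K) : Prop :=
  ∃ (a : AbsoluteValue L ℝ) (b : AbsoluteValue K ℝ),
    w.Contains a ∧ v.Contains b ∧ ∀ x : K, a (algebraMap K L x) = b x

end Place

/-- The set `W_v(L/K)` of places of `L` lying over the place `v` of `K`. -/
def PlacesOver {K : Type*} [Field K] (L : Type*) [Field L] [Algebra K L] (v : Place K) : Type _ :=
  {w : Place L // w.LiesOver v}

/-- The restriction to `K` of an absolute value of an extension field `L`. -/
def restrictAbs (K : Type*) {L : Type*} [Field K] [Field L] [Algebra K L]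
    (a : AbsoluteValue L ℝ) : AbsoluteValue K ℝ :=
  a.comp (algebraMap K L).injective

theorem isometry_map_restrictAbs (K : Type*) {L : Type*} [Field K] [Field L] [Algebra K L]
    (a : AbsoluteValue L ℝ) :
    Isometry (WithAbs.map (restrictAbs K a) a (algebraMap K L)) :=
  AddMonoidHomClass.isometry_of_norm _ fun _ => rfl

/-- The inclusion of completions `K_v → L_w`, where `a` is an absolute value in `w` and
`v` is the place of the restriction of `a` to `K`. -/
def completionMap (K : Type*) {L : Type*} [Field K] [Field L] [Algebra K L]
    (a : AbsoluteValue L ℝ) : (restrictAbs K a).Completion →+* a.Completion :=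
  (isometry_map_restrictAbs K a).mapRingHom

/-- The degree of the completion of `L` at `a` over the completion of `K` at the restriction
of `a`. -/
def localDegreeAbs (K : Type*) {L : Type*} [Field K] [Field L] [Algebra K L]
    (a : AbsoluteValue L ℝ) : ℕ :=
  letI : Algebra (restrictAbs K a).Completion a.Completion := (completionMap K a).toAlgebra
  Module.finrank (restrictAbs K a).Completion a.Completion

/-- The local degree `[L_w : K_v]`, where `v` is the place of `K` below `w`; it is computed with
an arbitrary absolute value chosen from `w`, and does not depend on that choice. -/
def localDegree (K : Type*) {L : Type*} [Field K] [Field L] [Algebra K L] (w : Place L) : ℕ :=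
  localDegreeAbs K (Quotient.out w).1

/-- A place `v` of `K` is well behaved if `∑_{w ∣ v} [L_w : K_v] = [L : K]` for all finite
extensions `L / K`. There are only finitely many `w ∣ v` and all local degrees are positive, so
the sum is an honest finite sum. -/
def WellBehaved {K : Type u} [Field K] (v : Place K) : Prop :=
  ∀ (L : Type u) [Field L] [Algebra K L] [FiniteDimensional K L],
    ∑ᶠ w : PlacesOver L v, localDegree K w.1 = Module.finrank K L

/-- A set `M` of places of `K`, with an absolute value `nrm v` chosen from each place `v ∈ M`,
is a proper set of absolute values. -/
structure IsProper {K : Type u} [Field K] (M : Set (Place K)) (nrm : M → AbsoluteValue K ℝ) :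
    Prop where
  contains : ∀ v : M, v.1.Contains (nrm v)
  wellBehaved : ∀ v ∈ M, WellBehaved v
  finite : ∀ α : K, α ≠ 0 → {v : M | nrm v α ≠ 1}.Finite
  product_formula : ∀ α : K, α ≠ 0 → ∏ᶠ v : M, nrm v α = 1

section Galois

variable {K : Type u} {N : Type w} [Field K] [Field N] [Algebra K N]

/-- The profinite topology on the set `Y(K, v)` of places of `N` over `v`: the coarsest topology
for which all restriction maps to the (discrete) sets `W_v(L/K)`, with `L / K` a finite Galois
subextension of `N / K`, are continuous. It is generated by the fibres of these maps. Under the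
identification of `Y(K, v)` with the inverse limit of the sets `W_v(L/K)` this is the
inverse limit topology. -/
instance PlacesOver.topologicalSpace (v : Place K) : TopologicalSpace (PlacesOver N v) :=
  TopologicalSpace.generateFrom
    {U | ∃ (L : FiniteGaloisIntermediateField K N) (w : PlacesOver L v),
      U = {y : PlacesOver N v | y.1.LiesOver w.1}}

/-- The absolute value `x ↦ a (τ⁻¹ x)`. -/
def galAbs (τ : Gal(N/K)) (a : AbsoluteValue N ℝ) : AbsoluteValue N ℝ :=
  a.comp (f := (τ.symm : N →+* N)) τ.symm.injective

theorem galAbs_apply (τ : Gal(N/K)) (a : AbsoluteValue N ℝ) (x : N) :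
    galAbs τ a x = a (τ⁻¹ x) := rfl

theorem galAbs_isNontrivial (τ : Gal(N/K)) {a : AbsoluteValue N ℝ} (h : a.IsNontrivial) :
    (galAbs τ a).IsNontrivial := by
  obtain ⟨x, hx, hx1⟩ := h
  refine ⟨τ x, by simpa using hx, ?_⟩
  simpa [galAbs_apply, AlgEquiv.aut_inv] using hx1

/-- The action of `Gal(N/K)` on the places of `N`: `‖x‖_{τ y} = ‖τ⁻¹ x‖_y`. -/
instance Place.galSMul : SMul Gal(N/K) (Place N) where
  smul τ y := Quotient.map (sa := placeSetoid N) (sb := placeSetoid N)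
    (fun a => ⟨galAbs τ a.1, galAbs_isNontrivial τ a.2⟩)
    (fun _ _ h x y => h (τ⁻¹ x) (τ⁻¹ y)) y

theorem Place.LiesOver.smul (τ : Gal(N/K)) {y : Place N} {v : Place K} (h : y.LiesOver v) :
    (τ • y).LiesOver v := by
  obtain ⟨a, b, ⟨ha, rfl⟩, hb, hab⟩ := h
  refine ⟨galAbs τ a, b, ⟨galAbs_isNontrivial τ ha, rfl⟩, hb, fun x => ?_⟩
  rw [galAbs_apply, AlgEquiv.commutes, hab]

/-- The induced action of `Gal(N/K)` on `Y(K, v)`. -/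
instance PlacesOver.galSMul (v : Place K) : SMul Gal(N/K) (PlacesOver N v) where
  smul τ y := ⟨τ • y.1, y.2.smul τ⟩

variable (N) in
/-- The space `Y`: the topological disjoint union of the spaces `Y(K, v)`, `v ∈ M`. -/
abbrev PlaceSpace (M : Set (Place K)) : Type _ := Σ v : M, PlacesOver N v.1

/-- The action of `Gal(N/K)` on `Y`, which preserves each `Y(K, v)`. -/
instance PlaceSpace.galSMul (M : Set (Place K)) : SMul Gal(N/K) (PlaceSpace N M) where
  smul τ y := ⟨y.1, τ • y.2⟩

/-- The subset `Y(K, v)` of `Y`. -/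
def PlaceSpace.fiber {M : Set (Place K)} (v : M) : Set (PlaceSpace N M) := {y | y.1 = v}

/-- The functional `I(F) = ∑_v ∫_G F(τ z_v) dμ(τ)` on `C_c(Y)`, computed with the base points
`z_v ∈ Y(K, v)`. -/
def placeFunctional {M : Set (Place K)} [MeasurableSpace Gal(N/K)] (μ : Measure Gal(N/K))
    (z : ∀ v : M, PlacesOver N v.1) (F : C_c(PlaceSpace N M, ℝ)) : ℝ :=
  ∑ᶠ v : M, ∫ τ : Gal(N/K), F ⟨v, τ • z v⟩ ∂μ

end Galois

end

/-! ### Extending absolute values -/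

/-! The measure is the completion of the Riesz–Markov–Kakutani measure of $I$; the work lies in
making $Y$ locally compact Hausdorff, with a Galois action that is transitive on each $Y(K,v)$.

Nonemptiness: a sum of local degrees equal to $[L:K]>0$ has a term, so $v$ extends to every finite
$L$. After rescaling, all these extensions restrict to one fixed absolute value of $K$, and
compactness in a product of intervals gives an extension to $N$ (`exists_restrictAbs_eq_of_finite`).
Transitivity: at finite level, weak approximation and the norm (`exists_galAbs_isEquiv`); then
compactness of $G$ (`PlacesOver.exists_smul_eq`). So $Y(K,v)$ is a continuous image of $G$, hence
compact, and it is Hausdorff because finite levels separate places.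

A compact subset of $Y$ meets finitely many fibres, so $I$ is a finite sum on each $F$ and is
positive linear. Right invariance of $\mu$ gives independence of $z_v$; left invariance gives
invariance of $I$, hence of $\lambda$, under $G$. Completing the Borel measure leaves the measure of
every set unchanged, so regularity survives (`exists_complete_rieszMeasure`). Since the fibres are
compact and open, they have finite measure, which yields (iii). -/

theorem le_of_forall_pow_le_mul_pow {A B c : ℝ} (hA : 0 ≤ A) (hB : 0 ≤ B)
    (h : ∀ n : ℕ, A ^ n ≤ ((n : ℝ) + 1) ^ c * B ^ n) : A ≤ B := by
  by_contra! hlt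
  have hApos : 0 < A := hB.trans_lt hlt
  obtain ⟨k, hk⟩ := exists_nat_ge c
  -- A polynomial factor cannot compensate the geometric decay of `(B / A) ^ n`. The limit is
  -- available at index `n + 1`; dividing by `B / A` restores exponent `n`, which is why `B = 0` is
  -- treated apart.
  have hr0 : 0 ≤ B / A := div_nonneg hB hA
  have hr1 : B / A < 1 := (div_lt_one hApos).2 hlt
  have hlim := (tendsto_pow_const_mul_const_pow_of_abs_lt_one k
    (by rwa [abs_of_nonneg hr0] : |B / A| < 1)).comp (Filter.tendsto_add_atTop_nat 1)
  rcases hB.eq_or_lt with rfl | hBpos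
  · have := h 1
    norm_num at this
    linarith
  have hlim' : Filter.Tendsto (fun n : ℕ => ((n : ℝ) + 1) ^ k * (B / A) ^ n)
      Filter.atTop (nhds 0) := by
    have := hlim.div_const (B / A)
    rw [zero_div] at this
    refine this.congr fun n => ?_
    have : B / A ≠ 0 := (div_pos hBpos hApos).ne'
    simp only [Function.comp, pow_succ]
    push_cast
    field_simp
  obtain ⟨m, hm⟩ := (hlim'.eventually_lt_const one_pos).exists
  have h1 : ((m : ℝ) + 1) ^ c ≤ ((m : ℝ) + 1) ^ k := by
    rw [← Real.rpow_natCast]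
    exact Real.rpow_le_rpow_of_exponent_le (by linarith [m.cast_nonneg (α := ℝ)]) hk
  have h2 : A ^ m ≤ ((m : ℝ) + 1) ^ k * B ^ m :=
    (h m).trans (mul_le_mul_of_nonneg_right h1 (by positivity))
  rw [div_pow, ← mul_div_assoc, div_lt_one (by positivity)] at hm
  linarith

/-- Bound every term by the $\ell^c$ quasi-norm. The constant is crude but valid for all $c>0$, and
its growth, polynomial in the cardinality, disappears on taking $n$-th roots. -/
theorem Finset.rpow_sum_le_card_rpow_mul_sum {ι : Type*} (s : Finset ι) {t : ι → ℝ}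
    (ht : ∀ i ∈ s, 0 ≤ t i) {c : ℝ} (hc : 0 < c) :
    (∑ i ∈ s, t i) ^ c ≤ (s.card : ℝ) ^ c * ∑ i ∈ s, t i ^ c := by
  have hT : 0 ≤ ∑ i ∈ s, t i ^ c := Finset.sum_nonneg fun i hi => Real.rpow_nonneg (ht i hi) _
  have h1 : ∀ i ∈ s, t i ≤ (∑ j ∈ s, t j ^ c) ^ c⁻¹ := fun i hi => by
    rw [Real.le_rpow_inv_iff_of_pos (ht i hi) hT hc]
    exact Finset.single_le_sum (f := fun j => t j ^ c)
      (fun j hj => Real.rpow_nonneg (ht j hj) _) hi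
  have h2 := Finset.sum_le_card_nsmul s t _ h1
  rw [nsmul_eq_mul] at h2
  calc (∑ i ∈ s, t i) ^ c ≤ (s.card * (∑ j ∈ s, t j ^ c) ^ c⁻¹) ^ c :=
        Real.rpow_le_rpow (Finset.sum_nonneg ht) h2 hc.le
    _ = _ := by
        rw [Real.mul_rpow (by positivity) (Real.rpow_nonneg hT _), Real.rpow_inv_rpow hT hc.ne']

/-- A positive power of an absolute value is again an absolute value as soon as it is bounded
by `n` at every natural number `n`. -/
theorem AbsoluteValue.rpow_add_le {L : Type*} [Field L] (a : AbsoluteValue L ℝ) {c : ℝ}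
    (hc : 0 < c) (hn : ∀ n : ℕ, a n ^ c ≤ n) (x y : L) :
    a (x + y) ^ c ≤ a x ^ c + a y ^ c := by
  have hx := Real.rpow_nonneg (a.nonneg x) c
  have hy := Real.rpow_nonneg (a.nonneg y) c
  -- Power trick: compare $n$-th powers by the binomial theorem. The hypothesis on natural numbers
  -- is used on the binomial coefficients, and the number `n + 1` of terms costs only a polynomial
  -- factor.
  refine le_of_forall_pow_le_mul_pow (c := c) (Real.rpow_nonneg (a.nonneg _) _)
    (add_nonneg hx hy) fun n => ?_
  have hpow (z : L) (m : ℕ) : (a z ^ c) ^ m = (a (z ^ m)) ^ c := by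
    rw [map_pow, Real.rpow_pow_comm (a.nonneg z)]
  calc (a (x + y) ^ c) ^ n
      = a (∑ m ∈ Finset.range (n + 1), x ^ m * y ^ (n - m) * (n.choose m : L)) ^ c := by
        rw [hpow, add_pow]
    _ ≤ (∑ m ∈ Finset.range (n + 1), a (x ^ m * y ^ (n - m) * (n.choose m : L))) ^ c :=
        Real.rpow_le_rpow (a.nonneg _) (a.sum_le _ _) hc.le
    _ ≤ ((n : ℝ) + 1) ^ c * ∑ m ∈ Finset.range (n + 1),
          a (x ^ m * y ^ (n - m) * (n.choose m : L)) ^ c := by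
        simpa using Finset.rpow_sum_le_card_rpow_mul_sum (Finset.range (n + 1))
          (t := fun m => a (x ^ m * y ^ (n - m) * (n.choose m : L))) (fun _ _ => a.nonneg _) hc
    _ ≤ _ := by
        rw [add_pow]
        gcongr with m
        rw [map_mul, map_mul, Real.mul_rpow (by positivity) (a.nonneg _),
          Real.mul_rpow (a.nonneg _) (a.nonneg _), hpow, hpow]
        exact mul_le_mul_of_nonneg_left (hn _) (by positivity)

theorem restrictAbs_apply (K : Type*) {L : Type*} [Field K] [Field L] [Algebra K L]
    (a : AbsoluteValue L ℝ) (x : K) : restrictAbs K a x = a (algebraMap K L x) := rfl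

/-- An absolute value of `L` can be rescaled within its class so that its restriction to `K` is a
prescribed absolute value. -/
theorem exists_isEquiv_restrictAbs_eq {K L : Type*} [Field K] [Field L] [Algebra K L]
    (a : AbsoluteValue L ℝ) (b : AbsoluteValue K ℝ) (h : (restrictAbs K a).IsEquiv b) :
    ∃ a' : AbsoluteValue L ℝ, a.IsEquiv a' ∧ restrictAbs K a' = b := by
  obtain ⟨c, hc, hcb⟩ := AbsoluteValue.isEquiv_iff_exists_rpow_eq.1 h
  have hcb' (x : K) : a (algebraMap K L x) ^ c = b x := congrFun hcb x
  have hn (n : ℕ) : a n ^ c ≤ n := by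
    have := hcb' n
    rw [map_natCast] at this
    rw [this]
    exact b.apply_nat_le_self n
  let a' : AbsoluteValue L ℝ :=
    { toFun x := a x ^ c
      map_mul' x y := by rw [map_mul, Real.mul_rpow (a.nonneg _) (a.nonneg _)]
      nonneg' x := Real.rpow_nonneg (a.nonneg _) _
      eq_zero' x := by rw [Real.rpow_eq_zero (a.nonneg _) hc.ne', a.eq_zero]
      add_le' x y := a.rpow_add_le hc hn x y }
  exact ⟨a', AbsoluteValue.isEquiv_iff_exists_rpow_eq.2 ⟨c, hc, rfl⟩,
    AbsoluteValue.ext hcb'⟩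

/-- An absolute value is bounded at an integral element in terms of its values
at the coefficients of the minimal polynomial. -/
theorem restrictAbs_bound {K L : Type*} [Field K] [Field L] [Algebra K L]
    (a : AbsoluteValue L ℝ) {x : L} (hx : IsIntegral K x) :
    a x ≤ max 1 (∑ i ∈ Finset.range (minpoly K x).natDegree,
      restrictAbs K a ((minpoly K x).coeff i)) := by
  rcases le_total (a x) 1 with h1 | h1
  · exact h1.trans (le_max_left _ _)
  refine le_trans ?_ (le_max_right _ _)
  set n := (minpoly K x).natDegree with hn
  obtain ⟨m, hm⟩ : ∃ m, n = m + 1 :=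
    Nat.exists_eq_succ_of_ne_zero (minpoly.natDegree_pos hx).ne'
  have hroot := minpoly.aeval K x
  rw [Polynomial.aeval_eq_sum_range, Finset.sum_range_succ, ← hn,
    show (minpoly K x).coeff n = 1 from minpoly.monic hx, one_smul] at hroot
  have hxn : a x ^ n ≤ ∑ i ∈ Finset.range n,
      restrictAbs K a ((minpoly K x).coeff i) * a x ^ m := by
    rw [← map_pow, eq_neg_of_add_eq_zero_right hroot, a.map_neg]
    refine (a.sum_le _ _).trans (Finset.sum_le_sum fun i hi => ?_)
    rw [Algebra.smul_def, map_mul, map_pow]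
    refine mul_le_mul_of_nonneg_left (pow_le_pow_right₀ h1 ?_) (a.nonneg _)
    have := Finset.mem_range.1 hi
    omega
  -- Cauchy's root bound: cancel the common factor `a x ^ m`.
  rw [← Finset.sum_mul, hm, pow_succ', ← hm] at hxn
  exact le_of_mul_le_mul_right hxn (by positivity)

/-- An absolute value of `K` that extends to every finite subextension of an algebraic extension
`N / K` extends to `N`. -/
theorem exists_restrictAbs_eq_of_finite {K N : Type*} [Field K] [Field N] [Algebra K N]
    [Algebra.IsAlgebraic K N] (b : AbsoluteValue K ℝ)
    (h : ∀ L : IntermediateField K N, FiniteDimensional K L →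
      ∃ a : AbsoluteValue L ℝ, restrictAbs K a = b) :
    ∃ a : AbsoluteValue N ℝ, restrictAbs K a = b := by
  classical
  -- The bound involves only `b`, so one compact box contains the candidates from all finite levels.
  let C : N → ℝ := fun x => max 1 (∑ i ∈ Finset.range (minpoly K x).natDegree,
    b ((minpoly K x).coeff i))
  let box : Set (N → ℝ) := Set.univ.pi fun x => Set.Icc 0 (C x)
  let A : Finset N → IntermediateField K N := fun s => IntermediateField.adjoin K (s : Set N)
  let S : Finset N → Set (N → ℝ) := fun s => box ∩ {f | (∀ x ∈ A s, ∀ y ∈ A s,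
    f (x * y) = f x * f y ∧ f (x + y) ≤ f x + f y) ∧ ∀ k : K, f (algebraMap K N k) = b k}
  have hAmono {s t : Finset N} (hst : s ⊆ t) : A s ≤ A t :=
    IntermediateField.adjoin.mono K _ _ (by exact_mod_cast hst)
  have hbox : IsCompact box := isCompact_univ_pi fun _ => isCompact_Icc
  have hclosed (s : Finset N) : IsClosed {f : N → ℝ | (∀ x ∈ A s, ∀ y ∈ A s,
      f (x * y) = f x * f y ∧ f (x + y) ≤ f x + f y) ∧ ∀ k : K, f (algebraMap K N k) = b k} := by
    simp only [Set.ofPred_and, Set.ofPred_forall]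
    refine IsClosed.inter (isClosed_iInter fun x => isClosed_iInter fun _ =>
      isClosed_iInter fun y => isClosed_iInter fun _ => IsClosed.inter ?_ ?_)
      (isClosed_iInter fun k => ?_)
    · exact isClosed_eq (by fun_prop) (by fun_prop)
    · exact isClosed_le (by fun_prop) (by fun_prop)
    · exact isClosed_eq (by fun_prop) (by fun_prop)
  have hne : (⋂ s, S s).Nonempty := by
    refine IsCompact.nonempty_iInter_of_directed_nonempty_isCompact_isClosed S ?_ ?_
      (fun s => hbox.inter_right (hclosed s)) (fun s => hbox.isClosed.inter (hclosed s))
    · refine directed_of_isDirected_le fun s t hst f hf =>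
        ⟨hf.1, fun x hx y hy => hf.2.1 x (hAmono hst hx) y (hAmono hst hy), hf.2.2⟩
    · intro s
      have hfin : FiniteDimensional K (A s) :=
        IntermediateField.finiteDimensional_adjoin fun x _ =>
          Algebra.IsIntegral.isIntegral (R := K) x
      obtain ⟨a, ha⟩ := h (A s) hfin
      -- Outside `A s` the value is irrelevant to the condition indexed by `s`; zero stays in the
      -- box.
      refine ⟨fun x => if hx : x ∈ A s then a ⟨x, hx⟩ else 0, fun x _ => ?_, ?_, fun k => ?_⟩
      · dsimp only
        split_ifs with hx
        · refine ⟨a.nonneg _, ?_⟩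
          have := restrictAbs_bound a (x := (⟨x, hx⟩ : A s)) (Algebra.IsIntegral.isIntegral (R := K) _)
          rwa [ha, ← minpoly.algebraMap_eq (algebraMap (A s) N).injective] at this
        · exact ⟨le_rfl, zero_le_one.trans (le_max_left _ _)⟩
      · intro x hx y hy
        dsimp only
        rw [dif_pos hx, dif_pos hy, dif_pos (mul_mem hx hy), dif_pos (add_mem hx hy)]
        exact ⟨a.map_mul ⟨x, hx⟩ ⟨y, hy⟩, a.add_le ⟨x, hx⟩ ⟨y, hy⟩⟩
      · dsimp only
        rw [dif_pos ((A s).algebraMap_mem k), ← ha]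
        rfl
  obtain ⟨f, hf⟩ := hne
  rw [Set.mem_iInter] at hf
  have hxy (x y : N) : f (x * y) = f x * f y ∧ f (x + y) ≤ f x + f y :=
    (hf {x, y}).2.1 x (IntermediateField.subset_adjoin K _ (by simp))
      y (IntermediateField.subset_adjoin K _ (by simp))
  have hfb : ∀ k : K, f (algebraMap K N k) = b k := (hf ∅).2.2
  let a : AbsoluteValue N ℝ :=
    { toFun := f
      map_mul' x y := (hxy x y).1
      nonneg' x := ((hf ∅).1 x trivial).1
      eq_zero' x := by
        refine ⟨fun hx => ?_, ?_⟩
        -- Definiteness is not a closed condition, so it was not imposed; it follows from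
        -- multiplicativity and `f 1 = b 1 = 1`.
        · by_contra hx0
          have h1 := (hxy x x⁻¹).1
          rw [mul_inv_cancel₀ hx0, hx, zero_mul, ← map_one (algebraMap K N), hfb, map_one] at h1
          exact one_ne_zero h1
        · rintro rfl
          rw [← map_zero (algebraMap K N), hfb, map_zero]
      add_le' x y := (hxy x y).2 }
  exact ⟨a, AbsoluteValue.ext hfb⟩

/-! ### Transitivity of the Galois action -/

theorem galAbs_mul {K L : Type*} [Field K] [Field L] [Algebra K L] (σ τ : Gal(L/K))
    (a : AbsoluteValue L ℝ) : galAbs (σ * τ) a = galAbs σ (galAbs τ a) :=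
  AbsoluteValue.ext fun x => by
    rw [galAbs_apply, galAbs_apply, galAbs_apply, mul_inv_rev, AlgEquiv.mul_apply]

theorem galAbs_isEquiv {K L : Type*} [Field K] [Field L] [Algebra K L] (σ : Gal(L/K))
    {a a' : AbsoluteValue L ℝ} (h : a.IsEquiv a') : (galAbs σ a).IsEquiv (galAbs σ a') :=
  fun x y => h (σ⁻¹ x) (σ⁻¹ y)

/-- Weak approximation: two finite families of nontrivial absolute values, no member of the first
being equivalent to a member of the second, are separated by an element. -/
theorem exists_lt_one_and_one_lt {F ι κ : Type*} [Field F] [Finite ι] [Finite κ]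
    (v : ι → AbsoluteValue F ℝ) (w : κ → AbsoluteValue F ℝ) (hv : ∀ i, (v i).IsNontrivial)
    (hw : ∀ j, (w j).IsNontrivial) (hvw : ∀ i j, ¬ (v i).IsEquiv (w j)) :
    ∃ x : F, (∀ i, v i x < 1) ∧ ∀ j, 1 < w j x := by
  classical
  let c : ι ⊕ κ → {a : AbsoluteValue F ℝ // a.IsNontrivial} :=
    Sum.elim (fun i => ⟨v i, hv i⟩) fun j => ⟨w j, hw j⟩
  -- The families may repeat a class, while approximation needs pairwise inequivalent absolute
  -- values; hence one representative per place.
  let T : Set (Place F) := Set.range fun s => (Quotient.mk (placeSetoid F) (c s) : Place F)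
  have hTfin : Finite T := Set.finite_range _
  let r : T → AbsoluteValue F ℝ := fun t => (Quotient.out t.1).1
  have hr (s : ι ⊕ κ) : (r ⟨_, s, rfl⟩).IsEquiv (c s).1 :=
    Quotient.exact (s := placeSetoid F) (Quotient.out_eq _)
  have hrn (t : T) : (r t).IsNontrivial := (Quotient.out t.1).2
  have hpair : Pairwise fun s t => ¬ (r s).IsEquiv (r t) := by
    intro s t hst h
    refine hst (Subtype.ext ?_)
    rw [← Quotient.out_eq s.1, ← Quotient.out_eq t.1]
    exact Quotient.sound (s := placeSetoid F) h
  choose g hg using fun t => (hrn t).exists_abv_gt_one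
  let P : T → Prop := fun t => ∃ i, (r t).IsEquiv (v i)
  let z : (t : T) → WithAbs (r t) := fun t =>
    if P t then 0 else (WithAbs.equiv (r t)).symm (g t)
  let U : Set ((t : T) → WithAbs (r t)) := Set.univ.pi fun t =>
    if P t then {f | ‖f‖ < 1} else {f | 1 < ‖f‖}
  have hU : IsOpen U := isOpen_set_pi Set.finite_univ fun t _ => by
    split_ifs
    · exact isOpen_lt continuous_norm continuous_const
    · exact isOpen_lt continuous_const continuous_norm
  obtain ⟨x, hx⟩ := (AbsoluteValue.denseRange_algebraMap_pi hrn hpair).exists_mem_open hU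
    ⟨z, fun t _ => by
      by_cases ht : P t
      · simp [z, ht]
      · simpa [z, ht, WithAbs.norm_eq_apply_ofAbs] using hg t⟩
  refine ⟨x, fun i => ?_, fun j => ?_⟩
  · have h1 := hx ⟨_, Sum.inl i, rfl⟩ trivial
    have hP : P ⟨_, Sum.inl i, rfl⟩ := ⟨i, hr (Sum.inl i)⟩
    dsimp only at h1
    rw [if_pos hP] at h1
    exact (hr (Sum.inl i)).lt_one_iff.1 h1
  · have h1 := hx ⟨_, Sum.inr j, rfl⟩ trivial
    have hP : ¬ P ⟨_, Sum.inr j, rfl⟩ := fun ⟨i, hi⟩ =>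
      hvw i j (hi.symm.trans (hr (Sum.inr j)))
    dsimp only at h1
    rw [if_neg hP] at h1
    exact (hr (Sum.inr j)).one_lt_iff.1 h1

/-- The Galois group of a finite extension acts transitively on the classes of absolute values
extending a given nontrivial class. -/
theorem exists_galAbs_isEquiv {K L : Type*} [Field K] [Field L] [Algebra K L]
    [FiniteDimensional K L] [IsGalois K L] (a a' : AbsoluteValue L ℝ) (ha : a.IsNontrivial)
    (ha' : a'.IsNontrivial) (h : (restrictAbs K a).IsEquiv (restrictAbs K a')) :
    ∃ σ : Gal(L/K), (galAbs σ a).IsEquiv a' := by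
  by_contra! hcon
  have hne (σ τ : Gal(L/K)) : ¬ (galAbs σ a).IsEquiv (galAbs τ a') := fun hστ => by
    have h1 := galAbs_isEquiv τ⁻¹ hστ
    rw [← galAbs_mul, ← galAbs_mul, inv_mul_cancel] at h1
    exact hcon _ h1
  obtain ⟨x, hx, hx'⟩ := exists_lt_one_and_one_lt (fun σ : Gal(L/K) => galAbs σ a)
    (fun σ => galAbs σ a') (fun σ => galAbs_isNontrivial σ ha)
    (fun σ => galAbs_isNontrivial σ ha') hne
  -- The norm of `x` lies in `K`, where `a` and `a'` restrict to equivalent absolute values, yet it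
  -- would be small for `a` and large for `a'`.
  have hprod (f : AbsoluteValue L ℝ) :
      restrictAbs K f (Algebra.norm K x) = ∏ σ : Gal(L/K), galAbs σ f x := by
    rw [restrictAbs_apply, Algebra.norm_eq_prod_automorphisms, map_prod]
    refine Fintype.prod_equiv (Equiv.inv _) _ _ fun σ => ?_
    rw [Equiv.inv_apply, galAbs_apply, inv_inv]
  have hx0 : x ≠ 0 := by
    rintro rfl
    have := hx' 1
    rw [map_zero] at this
    linarith
  have h1 : restrictAbs K a (Algebra.norm K x) < 1 := by
    rw [hprod]
    refine (Finset.prod_lt_prod_of_nonempty (fun σ _ => (galAbs σ a).pos hx0)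
      (fun σ _ => hx σ) Finset.univ_nonempty).trans_eq (Finset.prod_const_one)
  have h2 : 1 < restrictAbs K a' (Algebra.norm K x) := by
    rw [hprod]
    refine Finset.prod_const_one.symm.trans_lt (Finset.prod_lt_prod_of_nonempty
      (fun _ _ => one_pos) (fun σ _ => hx' σ) (Finset.univ_nonempty (α := Gal(L/K))))
  exact absurd (h.lt_one_iff.1 h1) h2.le.not_gt


/-! ### Places above a given place -/

namespace Place

variable {K L : Type*} [Field K] [Field L] [Algebra K L]

theorem exists_contains (v : Place K) : ∃ a, v.Contains a :=
  ⟨(Quotient.out v).1, (Quotient.out v).2, Quotient.out_eq v⟩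

theorem Contains.isNontrivial {v : Place K} {a : AbsoluteValue K ℝ} (h : v.Contains a) :
    a.IsNontrivial := h.1

theorem Contains.isEquiv {v : Place K} {a b : AbsoluteValue K ℝ} (ha : v.Contains a)
    (hb : v.Contains b) : a.IsEquiv b := by
  obtain ⟨ha0, rfl⟩ := ha
  exact (Quotient.exact (s := placeSetoid K) hb.2).symm

theorem Contains.of_isEquiv {v : Place K} {a b : AbsoluteValue K ℝ} (ha : v.Contains a)
    (h : a.IsEquiv b) : v.Contains b := by
  obtain ⟨ha0, rfl⟩ := ha
  exact ⟨h.isNontrivial ha0, Quotient.sound (s := placeSetoid K) h.symm⟩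

theorem Contains.eq {v w : Place K} {a : AbsoluteValue K ℝ} (hv : v.Contains a)
    (hw : w.Contains a) : v = w := by
  obtain ⟨_, rfl⟩ := hv
  exact hw.2

theorem Contains.smul {y : Place L} {a : AbsoluteValue L ℝ} (h : y.Contains a) (σ : Gal(L/K)) :
    (σ • y).Contains (galAbs σ a) := by
  obtain ⟨ha, rfl⟩ := h
  exact ⟨galAbs_isNontrivial σ ha, rfl⟩

/-- Equivalence of absolute values passes to restrictions, so any single representative of `y` can
test the existential in `Place.LiesOver`. -/
theorem liesOver_iff {y : Place L} {v : Place K} {a : AbsoluteValue L ℝ} (ha : y.Contains a) :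
    y.LiesOver v ↔ v.Contains (restrictAbs K a) := by
  refine ⟨?_, fun h => ⟨a, _, ha, h, fun _ => rfl⟩⟩
  rintro ⟨a', b, ha', hb, hab⟩
  have hb' : b = restrictAbs K a' := AbsoluteValue.ext fun x => (hab x).symm
  subst hb'
  exact hb.of_isEquiv fun x y => ha'.isEquiv ha _ _

end Place

/-- A place of `N` over `v` restricts to a unique place of an intermediate extension. -/
theorem PlacesOver.existsUnique_liesOver {K N : Type*} [Field K] [Field N] [Algebra K N]
    {v : Place K} (L : Type*) [Field L] [Algebra K L] [Algebra L N] [IsScalarTower K L N]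
    (y : PlacesOver N v) : ∃! w : PlacesOver L v, y.1.LiesOver w.1 := by
  obtain ⟨a, ha⟩ := y.1.exists_contains
  have hv := (Place.liesOver_iff ha).1 y.2
  have hKL : restrictAbs K (restrictAbs L a) = restrictAbs K a := AbsoluteValue.ext fun x => by
    simp only [restrictAbs_apply, ← IsScalarTower.algebraMap_apply]
  have hnt : (restrictAbs L a).IsNontrivial := by
    obtain ⟨x, hx, hx1⟩ := hv.isNontrivial
    exact ⟨algebraMap K L x, by simpa using hx, by rwa [← hKL] at hx1⟩
  let w : Place L := Quotient.mk (placeSetoid L) ⟨_, hnt⟩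
  have hw : w.Contains (restrictAbs L a) := ⟨hnt, rfl⟩
  refine ⟨⟨w, (Place.liesOver_iff hw).2 (by rwa [hKL])⟩, (Place.liesOver_iff ha).2 hw,
    fun w' hw' => Subtype.ext (((Place.liesOver_iff ha).1 hw').eq hw)⟩

/-! ### Restriction of places in a tower -/

section Tower

variable {K N : Type*} [Field K] [Field N] [Algebra K N] {v : Place K}
  (L : Type*) [Field L] [Algebra K L] [Algebra L N] [IsScalarTower K L N]

/-- The restriction map from the places of `N` over `v` to those of an intermediate extension. -/
noncomputable def PlacesOver.restr (y : PlacesOver N v) : PlacesOver L v :=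
  (y.existsUnique_liesOver L).choose

theorem PlacesOver.liesOver_restr (y : PlacesOver N v) : y.1.LiesOver (y.restr L).1 :=
  (y.existsUnique_liesOver L).choose_spec.1

variable {L} in
theorem PlacesOver.liesOver_iff_restr_eq {y : PlacesOver N v} {w : PlacesOver L v} :
    y.1.LiesOver w.1 ↔ y.restr L = w :=
  ⟨fun h => (y.existsUnique_liesOver L).unique (y.liesOver_restr L) h,
    fun h => h ▸ y.liesOver_restr L⟩

theorem PlacesOver.contains_restr {y : PlacesOver N v} {a : AbsoluteValue N ℝ}
    (ha : y.1.Contains a) : (y.restr L).1.Contains (restrictAbs L a) :=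
  (Place.liesOver_iff ha).1 (y.liesOver_restr L)

theorem PlacesOver.restr_eq_restr_iff {y y' : PlacesOver N v} {a a' : AbsoluteValue N ℝ}
    (ha : y.1.Contains a) (ha' : y'.1.Contains a') :
    y.restr L = y'.restr L ↔ (restrictAbs L a).IsEquiv (restrictAbs L a') := by
  refine ⟨fun h => ?_, fun h => ?_⟩
  · have := PlacesOver.contains_restr L ha
    rw [h] at this
    exact this.isEquiv (PlacesOver.contains_restr L ha')
  · exact Subtype.ext (((PlacesOver.contains_restr L ha).of_isEquiv h).eq
      (PlacesOver.contains_restr L ha'))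

end Tower

/-! ### The profinite topology and the Galois action on the places over `v` -/

section GaloisAction

variable {K : Type u} {N : Type w} [Field K] [Field N] [Algebra K N] {v : Place K}

theorem PlacesOver.contains_smul {y : PlacesOver N v} {a : AbsoluteValue N ℝ}
    (ha : y.1.Contains a) (τ : Gal(N/K)) : (τ • y).1.Contains (galAbs τ a) :=
  Place.Contains.smul ha τ

theorem PlacesOver.eq_of_contains {y y' : PlacesOver N v} {a : AbsoluteValue N ℝ}
    (h : y.1.Contains a) (h' : y'.1.Contains a) : y = y' :=
  Subtype.ext (h.eq h')

theorem PlacesOver.mul_smul (σ τ : Gal(N/K)) (y : PlacesOver N v) : (σ * τ) • y = σ • τ • y := by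
  obtain ⟨a, ha⟩ := y.1.exists_contains
  refine PlacesOver.eq_of_contains (contains_smul ha _) ?_
  rw [galAbs_mul]
  exact contains_smul (contains_smul ha _) _

theorem PlacesOver.one_smul (y : PlacesOver N v) : (1 : Gal(N/K)) • y = y := by
  obtain ⟨a, ha⟩ := y.1.exists_contains
  exact PlacesOver.eq_of_contains (contains_smul ha _) ha

theorem restrictAbs_galAbs_restrictNormalHom (L : IntermediateField K N) [Normal K L]
    (τ : Gal(N/K)) (a : AbsoluteValue N ℝ) :
    restrictAbs L (galAbs τ a) =
      galAbs (AlgEquiv.restrictNormalHom L τ) (restrictAbs L a) := by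
  refine AbsoluteValue.ext fun x => ?_
  rw [restrictAbs_apply, galAbs_apply, galAbs_apply, restrictAbs_apply, ← map_inv]
  congr 1
  exact (AlgEquiv.restrictNormal_commutes τ⁻¹ L x).symm

theorem PlacesOver.restr_smul (L : IntermediateField K N) [Normal K L] (τ : Gal(N/K))
    (y : PlacesOver N v) :
    (τ • y).restr L = AlgEquiv.restrictNormalHom L τ • y.restr L := by
  obtain ⟨a, ha⟩ := y.1.exists_contains
  refine eq_of_contains (contains_restr L (contains_smul ha τ)) ?_
  rw [restrictAbs_galAbs_restrictNormalHom]
  exact contains_smul (contains_restr L ha) _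

/-- The Galois group of a finite Galois extension acts transitively on the places over `v`. -/
theorem PlacesOver.exists_smul_eq_of_finite {L : Type*} [Field L] [Algebra K L]
    [FiniteDimensional K L] [IsGalois K L] (w w' : PlacesOver L v) :
    ∃ σ : Gal(L/K), σ • w = w' := by
  obtain ⟨a, ha⟩ := w.1.exists_contains
  obtain ⟨a', ha'⟩ := w'.1.exists_contains
  obtain ⟨σ, hσ⟩ := exists_galAbs_isEquiv a a' ha.isNontrivial ha'.isNontrivial
    (((Place.liesOver_iff ha).1 w.2).isEquiv ((Place.liesOver_iff ha').1 w'.2))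
  exact ⟨σ, eq_of_contains ((contains_smul ha σ).of_isEquiv hσ) ha'⟩

theorem PlacesOver.isOpen_preimage_restr (L : FiniteGaloisIntermediateField K N)
    (s : Set (PlacesOver L v)) : IsOpen {y : PlacesOver N v | y.restr L ∈ s} := by
  have : {y : PlacesOver N v | y.restr L ∈ s} =
      ⋃ w ∈ s, {y : PlacesOver N v | y.1.LiesOver w.1} := by
    ext y
    simp [liesOver_iff_restr_eq]
  rw [this]
  exact isOpen_biUnion fun w _ => TopologicalSpace.isOpen_generateFrom_of_mem ⟨L, w, rfl⟩

theorem PlacesOver.isClosed_preimage_restr (L : FiniteGaloisIntermediateField K N)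
    (s : Set (PlacesOver L v)) : IsClosed {y : PlacesOver N v | y.restr L ∈ s} :=
  ⟨isOpen_preimage_restr L sᶜ⟩

theorem PlacesOver.continuous_of_restr {X : Type*} [TopologicalSpace X]
    {f : X → PlacesOver N v}
    (h : ∀ (L : FiniteGaloisIntermediateField K N) (w : PlacesOver L v),
      IsOpen {x | (f x).restr L = w}) : Continuous f := by
  refine continuous_generateFrom_iff.2 ?_
  rintro _ ⟨L, w, rfl⟩
  simpa only [Set.preimage_ofPred_eq, liesOver_iff_restr_eq] using h L w

/-- At level `L` the orbit map factors through the discrete group `Gal(L/K)`. -/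
theorem PlacesOver.continuous_smul_left (z : PlacesOver N v) :
    Continuous fun τ : Gal(N/K) => τ • z := by
  refine continuous_of_restr fun L w => ?_
  have hc := InfiniteGalois.restrictNormalHom_continuous (k := K) L.toIntermediateField
  have : {τ : Gal(N/K) | (τ • z).restr L = w} =
      (AlgEquiv.restrictNormalHom L.toIntermediateField) ⁻¹'
        {σ : Gal(L/K) | σ • z.restr L = w} := by
    ext τ
    simp only [Set.mem_ofPred_eq, Set.mem_preimage, restr_smul]
  rw [this]
  exact (isOpen_discrete _).preimage hc

theorem PlacesOver.continuous_smul_right (τ : Gal(N/K)) :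
    Continuous fun y : PlacesOver N v => τ • y := by
  refine continuous_of_restr fun L w => ?_
  simp only [restr_smul]
  exact isOpen_preimage_restr L {w' | AlgEquiv.restrictNormalHom L.toIntermediateField τ • w' = w}

theorem PlacesOver.restr_eq_of_le {L L' : FiniteGaloisIntermediateField K N} (hL : L ≤ L')
    {y y' : PlacesOver N v} (h : y.restr L' = y'.restr L') : y.restr L = y'.restr L := by
  obtain ⟨a, ha⟩ := y.1.exists_contains
  obtain ⟨a', ha'⟩ := y'.1.exists_contains
  rw [restr_eq_restr_iff _ ha ha'] at h ⊢
  exact fun x t => h ⟨x, hL x.2⟩ ⟨t, hL t.2⟩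

variable [IsGalois K N]

/-- Equivalence of absolute values compares two elements at a time, and any two lie in a common
finite Galois subextension. -/
theorem PlacesOver.ext_restr {y y' : PlacesOver N v}
    (h : ∀ L : FiniteGaloisIntermediateField K N, y.restr L = y'.restr L) : y = y' := by
  obtain ⟨a, ha⟩ := y.1.exists_contains
  obtain ⟨a', ha'⟩ := y'.1.exists_contains
  refine eq_of_contains (ha.of_isEquiv fun x t => ?_) ha'
  let L := FiniteGaloisIntermediateField.adjoin K ({x, t} : Set N)
  have hsub := FiniteGaloisIntermediateField.subset_adjoin K ({x, t} : Set N)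
  exact (restr_eq_restr_iff L ha ha').1 (h L) ⟨x, hsub (by simp)⟩ ⟨t, hsub (by simp)⟩

instance PlacesOver.t2Space : T2Space (PlacesOver N v) where
  t2 y y' hne := by
    obtain ⟨L, hL⟩ : ∃ L : FiniteGaloisIntermediateField K N, y.restr L ≠ y'.restr L := by
      by_contra! h
      exact hne (ext_restr h)
    exact ⟨_, _, isOpen_preimage_restr L {y.restr L}, isOpen_preimage_restr L {y.restr L}ᶜ,
      rfl, hL.symm, Set.disjoint_left.2 fun _ h h' => h' h⟩

/-- The Galois group acts transitively on the places over `v`. -/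
theorem PlacesOver.exists_smul_eq (y y' : PlacesOver N v) : ∃ τ : Gal(N/K), τ • y = y' := by
  -- The elements that work at level `L` form a directed family of closed sets in a compact group,
  -- each nonempty by finite transitivity and lifting of automorphisms.
  let S : FiniteGaloisIntermediateField K N → Set Gal(N/K) := fun L =>
    {τ | (τ • y).restr L = y'.restr L}
  have hclosed (L : FiniteGaloisIntermediateField K N) : IsClosed (S L) :=
    (isClosed_preimage_restr L {y'.restr L}).preimage (continuous_smul_left y)
  obtain ⟨τ, hτ⟩ : (⋂ L, S L).Nonempty := by
    refine IsCompact.nonempty_iInter_of_directed_nonempty_isCompact_isClosed S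
      (directed_of_isDirected_le fun L L' hL τ hτ => restr_eq_of_le hL hτ) (fun L => ?_)
      (fun L => (hclosed L).isCompact) hclosed
    obtain ⟨σ, hσ⟩ := exists_smul_eq_of_finite (y.restr L) (y'.restr L)
    obtain ⟨τ, rfl⟩ := AlgEquiv.restrictNormalHom_surjective (F := K) (K₁ := L) N σ
    exact ⟨τ, (restr_smul _ τ y).trans hσ⟩
  exact ⟨τ, ext_restr fun L => Set.mem_iInter.1 hτ L⟩

instance PlacesOver.compactSpace : CompactSpace (PlacesOver N v) := by
  rcases isEmpty_or_nonempty (PlacesOver N v) with h | ⟨⟨z⟩⟩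
  · infer_instance
  · have hs : Function.Surjective fun τ : Gal(N/K) => τ • z := exists_smul_eq z
    exact hs.compactSpace (continuous_smul_left z)

end GaloisAction

/-- A place of `K` whose local degrees add up correctly has a place above it in every finite
extension, in any universe. -/
theorem WellBehaved.nonempty_placesOver {K : Type u} [Field K] {v : Place K} (hv : WellBehaved v)
    (L : Type w) [Field L] [Algebra K L] [FiniteDimensional K L] : Nonempty (PlacesOver L v) := by
  -- `WellBehaved` ranges only over fields in the universe of `K`; coordinates in a basis allow `L`
  -- to be moved there.
  have : Small.{u} L := small_of_injective (Module.finBasis K L).equivFun.injective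
  let e : Shrink.{u} L ≃ₐ[K] L := Shrink.algEquiv K L
  have : FiniteDimensional K (Shrink.{u} L) := e.symm.toLinearEquiv.finiteDimensional
  have hsum := hv (Shrink.{u} L)
  obtain ⟨w⟩ : Nonempty (PlacesOver (Shrink.{u} L) v) := by
    by_contra hempty
    rw [not_nonempty_iff] at hempty
    rw [finsum_of_isEmpty] at hsum
    exact (Module.finrank_pos (R := K) (M := Shrink.{u} L)).ne hsum
  obtain ⟨a, ha⟩ := w.1.exists_contains
  have hv' := (Place.liesOver_iff ha).1 w.2
  let a' : AbsoluteValue L ℝ := a.comp (f := (e.symm : L →+* Shrink.{u} L)) e.symm.injective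
  have hres : restrictAbs K a' = restrictAbs K a := AbsoluteValue.ext fun x => by
    change a (e.symm (algebraMap K L x)) = _
    rw [AlgEquiv.commutes, restrictAbs_apply]
  have hnt : a'.IsNontrivial := by
    obtain ⟨x, hx, hx1⟩ := ha.isNontrivial
    refine ⟨e x, by simpa using hx, ?_⟩
    change a (e.symm (e x)) ≠ 1
    rwa [e.symm_apply_apply]
  have hw : Place.Contains (Quotient.mk (placeSetoid L) ⟨a', hnt⟩) a' := ⟨hnt, rfl⟩
  exact ⟨⟨_, (Place.liesOver_iff hw).2 (hres ▸ hv')⟩⟩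

/-- A well behaved place has a place above it in every algebraic extension. -/
theorem WellBehaved.nonempty_placesOver_of_isAlgebraic {K : Type u} [Field K] {v : Place K}
    (hv : WellBehaved v) (N : Type w) [Field N] [Algebra K N] [Algebra.IsAlgebraic K N] :
    Nonempty (PlacesOver N v) := by
  obtain ⟨b, hb⟩ := v.exists_contains
  obtain ⟨a, ha⟩ := exists_restrictAbs_eq_of_finite (N := N) b fun L _ => by
    obtain ⟨w⟩ := hv.nonempty_placesOver L
    obtain ⟨a, ha⟩ := w.1.exists_contains
    obtain ⟨a', -, ha'⟩ := exists_isEquiv_restrictAbs_eq a b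
      (((Place.liesOver_iff ha).1 w.2).isEquiv hb)
    exact ⟨a', ha'⟩
  have hnt : a.IsNontrivial := by
    obtain ⟨x, hx, hx1⟩ := hb.isNontrivial
    exact ⟨algebraMap K N x, by simpa using hx, by rwa [← ha] at hx1⟩
  have hw : Place.Contains (Quotient.mk (placeSetoid N) ⟨a, hnt⟩) a := ⟨hnt, rfl⟩
  exact ⟨⟨_, (Place.liesOver_iff hw).2 (ha ▸ hb)⟩⟩


/-! ### The completed Riesz–Markov–Kakutani measure -/

section Completion

variable {X : Type*}

/-- The completion of a regular measure, as a measure on a larger `σ`-algebra of the same space. -/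
theorem MeasureTheory.Measure.Regular.exists_completion [TopologicalSpace X]
    [m : MeasurableSpace X] (μ : Measure X) [μ.Regular] :
    ∃ (m' : MeasurableSpace X) (lam : @Measure X m'), m ≤ m' ∧ @Measure.Regular X m' _ lam ∧
      (∀ s, lam s = μ s) ∧ ∀ s, MeasurableSet[m'] s ↔ @NullMeasurableSet X m s μ := by
  refine ⟨inferInstanceAs (MeasurableSpace (NullMeasurableSpace X μ)), μ.completion,
    fun _ hs => hs.nullMeasurableSet, ?_, fun _ => rfl, fun _ => Iff.rfl⟩
  -- The completion agrees with `μ` on every set, so these facts about `μ` serve verbatim as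
  -- regularity of the completion.
  have h1 (K : Set X) (hK : IsCompact K) : μ K < ⊤ := hK.measure_lt_top
  have h2 (A : Set X) (r : ENNReal) (hr : μ A < r) := A.exists_isOpen_lt_of_lt r hr
  have h3 := Measure.Regular.innerRegular (μ := μ)
  exact @Measure.Regular.mk X (inferInstanceAs (MeasurableSpace (NullMeasurableSpace X μ))) _
    μ.completion (@IsFiniteMeasureOnCompacts.mk X (_) _ μ.completion h1)
    (@Measure.OuterRegular.mk X (_) _ μ.completion fun A _ r hr => h2 A r hr) h3

/-- Open and compact sets are Borel, so trimming does not change their measure. This reduces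
uniqueness on a larger σ-algebra to the Borel case. -/
theorem MeasureTheory.Measure.Regular.trim_borel [TopologicalSpace X] [T2Space X]
    [m' : MeasurableSpace X] (lam : Measure X) [lam.Regular] (hle : borel X ≤ m') :
    @Measure.Regular X (borel X) _ (lam.trim hle) := by
  have : OpensMeasurableSpace X := ⟨hle⟩
  have hB : @BorelSpace X _ (borel X) := @BorelSpace.mk X _ (borel X) rfl
  have ho {U : Set X} (hU : IsOpen U) : lam.trim hle U = lam U :=
    trim_measurableSet_eq hle (MeasurableSpace.measurableSet_generateFrom hU)
  have hc {C : Set X} (hC : IsCompact C) : lam.trim hle C = lam C :=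
    trim_measurableSet_eq hle (hC.isClosed.isOpen_compl |> fun h =>
      (@MeasurableSet.compl_iff X C (borel X)).1 (MeasurableSpace.measurableSet_generateFrom h))
  refine @Measure.Regular.mk X (borel X) _ _
    (@IsFiniteMeasureOnCompacts.mk X (borel X) _ _ fun C hC => ?_)
    (@Measure.OuterRegular.mk X (borel X) _ _ fun A hA r hr => ?_) fun U hU r hr => ?_
  · rw [hc hC]
    exact hC.measure_lt_top
  · rw [gt_iff_lt, trim_measurableSet_eq hle hA] at hr
    obtain ⟨U, hAU, hU, hr⟩ := A.exists_isOpen_lt_of_lt r hr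
    exact ⟨U, hAU, hU, by rwa [ho hU]⟩
  · rw [ho hU] at hr
    obtain ⟨C, hCU, hC, hr⟩ := Measure.Regular.innerRegular hU r hr
    exact ⟨C, hCU, hC, by rwa [hc hC]⟩

theorem CompactlySupportedContinuousMap.integral_trim_borel [TopologicalSpace X]
    [m' : MeasurableSpace X] (lam : Measure X) (hle : borel X ≤ m') (F : C_c(X, ℝ)) :
    ∫ x, F x ∂lam = ∫ x, F x ∂(lam.trim hle) := by
  have hB : @BorelSpace X _ (borel X) := @BorelSpace.mk X _ (borel X) rfl
  have hF : Measurable[borel X] F := F.continuous.borel_measurable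
  exact integral_trim hle hF.stronglyMeasurable

/-- Two regular measures on a `σ`-algebra containing the Borel sets agree if they integrate
compactly supported continuous functions in the same way. -/
theorem MeasureTheory.Measure.Regular.ext_of_integral_eq [TopologicalSpace X] [T2Space X]
    [LocallyCompactSpace X] [m' : MeasurableSpace X] (hle : borel X ≤ m') {lam lam' : Measure X}
    [lam.Regular] [lam'.Regular] (h : ∀ F : C_c(X, ℝ), ∫ x, F x ∂lam = ∫ x, F x ∂lam') :
    lam = lam' := by
  have hB : @BorelSpace X _ (borel X) := @BorelSpace.mk X _ (borel X) rfl
  have htrim : lam.trim hle = lam'.trim hle :=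
    @Measure.ext_of_integral_eq_on_compactlySupported X _ _ (borel X) _ _ _ _
      (trim_borel lam hle) (trim_borel lam' hle) fun F => by
        rw [← F.integral_trim_borel lam hle, ← F.integral_trim_borel lam' hle, h]
  -- Outer regularity carries equality from open sets to the whole larger σ-algebra.
  refine Measure.OuterRegular.ext_isOpen fun U hU => ?_
  have hU' : MeasurableSet[borel X] U := MeasurableSpace.measurableSet_generateFrom hU
  rw [← trim_measurableSet_eq hle hU', htrim, trim_measurableSet_eq hle hU']

/-- A homeomorphism preserving a Borel measure preserves its null measurable sets and their
measures. -/
theorem Homeomorph.nullMeasurableSet_preimage [TopologicalSpace X] [MeasurableSpace X]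
    [BorelSpace X] {μ : Measure X} (e : X ≃ₜ X) (he : μ.map e = μ) {s : Set X}
    (hs : NullMeasurableSet s μ) :
    NullMeasurableSet (e ⁻¹' s) μ ∧ NullMeasurableSet (e.symm ⁻¹' s) μ ∧ μ (e ⁻¹' s) = μ s := by
  have he1 : MeasurePreserving e μ μ := ⟨e.measurable, he⟩
  have he2 : MeasurePreserving e.symm μ μ := he1.symm e.toMeasurableEquiv
  exact ⟨hs.preimage he1.quasiMeasurePreserving, hs.preimage he2.quasiMeasurePreserving,
    he1.measure_preimage hs⟩

/-- A bijection preserving measurable sets and their measures in both directions. -/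
theorem MeasureTheory.MeasurePreserving.of_equiv [MeasurableSpace X] {lam : Measure X} (e : X ≃ X)
    (h : ∀ s, MeasurableSet s →
      MeasurableSet (e ⁻¹' s) ∧ MeasurableSet (e.symm ⁻¹' s) ∧ lam (e ⁻¹' s) = lam s) :
    MeasurePreserving e lam lam ∧ MeasurableEmbedding e := by
  have hm1 : Measurable e := fun s hs => (h s hs).1
  have hm2 : Measurable e.symm := fun s hs => (h s hs).2.1
  refine ⟨⟨hm1, Measure.ext fun s hs => ?_⟩, MeasurableEquiv.measurableEmbedding ⟨e, hm1, hm2⟩⟩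
  rw [Measure.map_apply hm1 hs, (h s hs).2.2]

/-- Inner regularity on null measurable sets covered by countably many measurable sets of finite
measure. -/
theorem MeasureTheory.NullMeasurableSet.measure_eq_iSup_isCompact [TopologicalSpace X]
    [MeasurableSpace X] [BorelSpace X] {μ : Measure X} [μ.Regular] {E : Set X}
    (hE : NullMeasurableSet E μ) {ι : Type*} (T : ι → Set X) (hTm : ∀ i, MeasurableSet (T i))
    (hT : ∀ i, μ (T i) ≠ ⊤) {c : Set ι} (hc : c.Countable) (hcov : E ⊆ ⋃ i ∈ c, T i) :
    μ E = ⨆ (V : Set X) (_ : V ⊆ E) (_ : IsCompact V), μ V := by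
  refine le_antisymm ?_ (iSup₂_le fun V hV => iSup_le fun _ => measure_mono hV)
  -- Compact subsets of this measurable `A` are also compact subsets of `E`; finite unions of the `T
  -- i` then exhaust `A` by sets of finite measure.
  obtain ⟨A, hAE, hA, hAeq⟩ := hE.exists_measurable_subset_ae_eq
  rw [← measure_congr hAeq]
  have := hc.to_subtype
  have hdir : Directed (· ⊆ ·) fun s : Finset c => A ∩ ⋃ i ∈ s, T i :=
    directed_of_isDirected_le fun s t hst =>
      Set.inter_subset_inter_right _ (Set.biUnion_subset_biUnion_left hst)
  have hAun : A = ⋃ s : Finset c, A ∩ ⋃ i ∈ s, T i := by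
    refine Set.Subset.antisymm (fun x hx => ?_)
      (Set.iUnion_subset fun s => Set.inter_subset_left)
    obtain ⟨i, hi, hxi⟩ := Set.mem_iUnion₂.1 (hcov (hAE hx))
    exact Set.mem_iUnion.2 ⟨{⟨i, hi⟩}, hx, by simpa using hxi⟩
  rw [hAun, hdir.measure_iUnion]
  refine iSup_le fun s => ?_
  have hmeas : MeasurableSet (A ∩ ⋃ i ∈ s, T i) :=
    hA.inter (s.measurableSet_biUnion fun i _ => hTm i)
  have hfin : μ (A ∩ ⋃ i ∈ s, T i) ≠ ⊤ := by
    refine ne_top_of_le_ne_top ?_ (measure_mono Set.inter_subset_right)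
    refine ne_top_of_le_ne_top ?_ (measure_biUnion_finset_le s _)
    exact ENNReal.sum_ne_top.2 fun i _ => hT i
  rw [hmeas.measure_eq_iSup_isCompact_of_ne_top hfin]
  exact iSup₂_le fun V hV => iSup_le fun hVc => le_iSup₂_of_le V
    (hV.trans (Set.inter_subset_left.trans hAE)) (le_iSup_of_le hVc le_rfl)

/-- The **Riesz–Markov–Kakutani theorem** with a complete measure: the representing measure lives on
a `σ`-algebra containing the Borel sets, on which it is regular, complete and unique, and it is
invariant under the homeomorphisms that preserve the functional. -/
theorem exists_complete_rieszMeasure [TopologicalSpace X] [T2Space X] [LocallyCompactSpace X]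
    (Λ : C_c(X, ℝ) →ₚ[ℝ] ℝ) :
    ∃ m' : MeasurableSpace X, borel X ≤ m' ∧ ∃ lam : Measure X, lam.Regular ∧
      (∀ F : C_c(X, ℝ), ∫ x, F x ∂lam = Λ F) ∧
      (∀ e : X ≃ₜ X, (∀ F F' : C_c(X, ℝ), (∀ x, F' x = F (e x)) → Λ F' = Λ F) →
        MeasurePreserving e lam lam ∧ MeasurableEmbedding e) ∧
      (∀ E, MeasurableSet E → ∀ (ι : Type u) (T : ι → Set X), (∀ i, IsOpen (T i)) →
        (∀ i, IsCompact (T i)) → ∀ c : Set ι, c.Countable → E ⊆ ⋃ i ∈ c, T i →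
        lam E = ⨆ (V : Set X) (_ : V ⊆ E) (_ : IsCompact V), lam V) ∧
      ∀ s, lam s = 0 → MeasurableSet s := by
  let m : MeasurableSpace X := borel X
  have hB : BorelSpace X := ⟨rfl⟩
  let μ : Measure X := RealRMK.rieszMeasure Λ
  have hμ : μ.Regular := RealRMK.regular_rieszMeasure Λ
  have hint (F : C_c(X, ℝ)) : ∫ x, F x ∂μ = Λ F := RealRMK.integral_rieszMeasure Λ F
  have hmap (e : X ≃ₜ X) (he : ∀ F F' : C_c(X, ℝ), (∀ x, F' x = F (e x)) → Λ F' = Λ F) :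
      μ.map e = μ := by
    have := Measure.Regular.map (μ := μ) e
    refine Measure.ext_of_integral_eq_on_compactlySupported fun F => ?_
    let F' : C_c(X, ℝ) := F.comp ⟨e, e.isClosedEmbedding.tendsto_cocompact⟩
    rw [integral_map (f := F) e.measurable.aemeasurable
      F.continuous.measurable.aestronglyMeasurable, hint, ← he F F' fun _ => rfl]
    exact hint F'
  have hpre (e : X ≃ₜ X) (he : ∀ F F' : C_c(X, ℝ), (∀ x, F' x = F (e x)) → Λ F' = Λ F)
      (s : Set X) (hs : NullMeasurableSet s μ) := e.nullMeasurableSet_preimage (hmap e he) hs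
  have hinner (E : Set X) (hE : NullMeasurableSet E μ) (ι : Type u) (T : ι → Set X)
      (hTo : ∀ i, IsOpen (T i)) (hTc : ∀ i, IsCompact (T i)) (c : Set ι) (hc : c.Countable)
      (hcov : E ⊆ ⋃ i ∈ c, T i) := hE.measure_eq_iSup_isCompact T
        (fun i => (hTo i).measurableSet) (fun i => (hTc i).measure_lt_top.ne) hc hcov
  have hnullset (s : Set X) (hs : μ s = 0) : NullMeasurableSet s μ := .of_null hs
  obtain ⟨m', lam, hle, hreg, hlam, hnull⟩ := Measure.Regular.exists_completion μ
  refine ⟨m', hle, lam, hreg, fun F => ?_, fun e he => ?_, ?_, fun s hs => ?_⟩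
  · have htrim : lam.trim hle = μ := @Measure.ext _ m _ _ fun s hs => by
      rw [trim_measurableSet_eq hle hs, hlam]
    rw [F.integral_trim_borel lam hle, htrim, hint]
  · refine MeasurePreserving.of_equiv e.toEquiv fun s hs => ?_
    obtain ⟨h1, h2, h3⟩ := hpre e he s ((hnull s).1 hs)
    exact ⟨(hnull _).2 h1, (hnull _).2 h2, by rw [hlam, hlam]; exact h3⟩
  · intro E hE
    simp only [hlam]
    exact hinner E ((hnull E).1 hE)
  · exact (hnull s).2 (hnullset s (by rwa [← hlam]))

end Completion

/-! ### The functional on the space of places -/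

section Functional

variable {K : Type u} {N : Type w} [Field K] [Field N] [Algebra K N] {M : Set (Place K)}

theorem PlaceSpace.fiber_eq_range (v : M) :
    (PlaceSpace.fiber v : Set (PlaceSpace N M)) = Set.range (Sigma.mk v) := by
  ext ⟨v', y⟩
  constructor
  · rintro rfl
    exact ⟨y, rfl⟩
  · rintro ⟨y', h⟩
    exact (congrArg Sigma.fst h).symm

theorem PlaceSpace.isOpen_fiber (v : M) :
    IsOpen (PlaceSpace.fiber v : Set (PlaceSpace N M)) := by
  rw [fiber_eq_range]
  exact isOpen_range_sigmaMk

theorem PlaceSpace.isCompact_fiber [IsGalois K N] (v : M) :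
    IsCompact (PlaceSpace.fiber v : Set (PlaceSpace N M)) := by
  rw [fiber_eq_range]
  exact isCompact_range continuous_sigmaMk

instance PlaceSpace.locallyCompactSpace [IsGalois K N] : LocallyCompactSpace (PlaceSpace N M) := by
  have : WeaklyLocallyCompactSpace (PlaceSpace N M) := ⟨fun y =>
    ⟨fiber y.1, isCompact_fiber y.1, (isOpen_fiber y.1).mem_nhds rfl⟩⟩
  infer_instance

/-- The homeomorphism of the space of places given by an element of the Galois group. -/
def PlaceSpace.smulHomeomorph (η : Gal(N/K)) : PlaceSpace N M ≃ₜ PlaceSpace N M where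
  toFun y := η • y
  invFun y := η⁻¹ • y
  left_inv y := Sigma.ext rfl (heq_of_eq (by
    change η⁻¹ • η • y.2 = y.2
    rw [← PlacesOver.mul_smul, inv_mul_cancel, PlacesOver.one_smul]))
  right_inv y := Sigma.ext rfl (heq_of_eq (by
    change η • η⁻¹ • y.2 = y.2
    rw [← PlacesOver.mul_smul, mul_inv_cancel, PlacesOver.one_smul]))
  continuous_toFun := continuous_sigma fun v =>
    continuous_sigmaMk.comp (PlacesOver.continuous_smul_right η)
  continuous_invFun := continuous_sigma fun v =>
    continuous_sigmaMk.comp (PlacesOver.continuous_smul_right η⁻¹)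

/-- Project the compact support to the index set with the discrete topology: compact there means
finite. -/
theorem CompactlySupportedContinuousMap.finite_setOf_sigma_ne_zero {ι : Type*} {Y : ι → Type*}
    [∀ i, TopologicalSpace (Y i)] (F : C_c((Σ i, Y i), ℝ)) :
    {i | ∃ y, F ⟨i, y⟩ ≠ 0}.Finite := by
  let _ : TopologicalSpace ι := ⊥
  have : DiscreteTopology ι := ⟨rfl⟩
  have hfst : Continuous (Sigma.fst : (Σ i, Y i) → ι) := continuous_sigma fun _ => continuous_const
  refine (F.hasCompactSupport.isCompact.image hfst).finite_of_discrete.subset ?_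
  rintro i ⟨y, hy⟩
  exact ⟨⟨i, y⟩, subset_tsupport _ hy, rfl⟩

variable [MeasurableSpace Gal(N/K)] (μ : Measure Gal(N/K))

theorem finite_support_placeFunctional (z : ∀ v : M, PlacesOver N v.1)
    (F : C_c(PlaceSpace N M, ℝ)) :
    (Function.support fun v : M => ∫ τ : Gal(N/K), F ⟨v, τ • z v⟩ ∂μ).Finite := by
  refine F.finite_setOf_sigma_ne_zero.subset fun v hv => ?_
  by_contra! hcon
  refine hv ?_
  simp only [Set.mem_ofPred_eq, not_exists, not_not] at hcon
  simp [hcon]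

variable [BorelSpace Gal(N/K)]

section

variable [IsGalois K N] [IsFiniteMeasure μ]

theorem integrable_comp_smul (z : ∀ v : M, PlacesOver N v.1) (F : C_c(PlaceSpace N M, ℝ))
    (v : M) : Integrable (fun τ : Gal(N/K) => F ⟨v, τ • z v⟩) μ := by
  have hc : Continuous fun τ : Gal(N/K) => F ⟨v, τ • z v⟩ :=
    F.continuous.comp (continuous_sigmaMk.comp (PlacesOver.continuous_smul_left (z v)))
  exact hc.integrable_of_hasCompactSupport (HasCompactSupport.of_compactSpace _)

/-- `placeFunctional` as a positive linear functional. -/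
noncomputable def placePositiveLinearMap (z : ∀ v : M, PlacesOver N v.1) :
    C_c(PlaceSpace N M, ℝ) →ₚ[ℝ] ℝ :=
  PositiveLinearMap.mk₀
    { toFun := placeFunctional μ z
      map_add' F F' := by
        simp only [placeFunctional]
        rw [← finsum_add_distrib (finite_support_placeFunctional μ z F)
          (finite_support_placeFunctional μ z F')]
        exact finsum_congr fun v =>
          integral_add (integrable_comp_smul μ z F v) (integrable_comp_smul μ z F' v)
      map_smul' r F := by
        simp only [placeFunctional]
        rw [smul_finsum' _ (finite_support_placeFunctional μ z F)]
        exact finsum_congr fun v => integral_smul r _ }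
    fun F hF => finsum_nonneg fun v => integral_nonneg fun τ => hF _

theorem placePositiveLinearMap_apply (z : ∀ v : M, PlacesOver N v.1)
    (F : C_c(PlaceSpace N M, ℝ)) : placePositiveLinearMap μ z F = placeFunctional μ z F := rfl

end

theorem placeFunctional_comp_smul [μ.IsMulLeftInvariant] (z : ∀ v : M, PlacesOver N v.1)
    (F F' : C_c(PlaceSpace N M, ℝ)) (η : Gal(N/K)) (h : ∀ y, F' y = F (η • y)) :
    placeFunctional μ z F' = placeFunctional μ z F := by
  refine finsum_congr fun v => ?_
  rw [← integral_mul_left_eq_self (fun τ => F ⟨v, τ • z v⟩) η]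
  simp only [PlacesOver.mul_smul, h]
  rfl

/-- A right translate of a Haar probability measure is again one, and such a measure is unique. -/
theorem MeasureTheory.Measure.isMulRightInvariant_of_isProbabilityMeasure {G : Type*} [Group G]
    [TopologicalSpace G] [IsTopologicalGroup G] [CompactSpace G] [MeasurableSpace G]
    [BorelSpace G] (μ : Measure G) [μ.IsHaarMeasure] [IsProbabilityMeasure μ] :
    μ.IsMulRightInvariant where
  map_mul_right_eq_self g := by
    have : IsProbabilityMeasure (μ.map (· * g)) :=
      Measure.isProbabilityMeasure_map (continuous_mul_const g).measurable.aemeasurable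
    exact Measure.isHaarMeasure_eq_of_isProbabilityMeasure _ _

variable [IsGalois K N] [μ.IsHaarMeasure] [IsProbabilityMeasure μ]

theorem integral_comp_mul_right_gal (g : Gal(N/K)) (f : Gal(N/K) → ℝ) :
    ∫ τ, f (τ * g) ∂μ = ∫ τ, f τ ∂μ := by
  have := Measure.isMulRightInvariant_of_isProbabilityMeasure μ
  exact integral_mul_right_eq_self f g

/-- The functional does not depend on the base points. -/
theorem placeFunctional_eq (z z' : ∀ v : M, PlacesOver N v.1) (F : C_c(PlaceSpace N M, ℝ)) :
    placeFunctional μ z F = placeFunctional μ z' F := by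
  refine finsum_congr fun v => ?_
  obtain ⟨g, hg⟩ := PlacesOver.exists_smul_eq (z' v) (z v)
  rw [← integral_comp_mul_right_gal μ g fun τ => F ⟨v, τ • z' v⟩]
  simp only [PlacesOver.mul_smul, hg]

end Functional

/-! ### The main theorem -/

theorem theorem4 {K : Type u} {N : Type w} [Field K] [Field N] [Algebra K N] [IsGalois K N]
    (M : Set (Place K)) (nrm : M → AbsoluteValue K ℝ) (hM : IsProper M nrm)
    [MeasurableSpace Gal(N/K)] [BorelSpace Gal(N/K)]
    (μ : Measure Gal(N/K)) [μ.IsHaarMeasure] [IsProbabilityMeasure μ] :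
    (∀ v : M, Nonempty (PlacesOver N v.1)) ∧
    ∃ 𝒴 : MeasurableSpace (PlaceSpace N M), borel (PlaceSpace N M) ≤ 𝒴 ∧
    ∃ lam : Measure (PlaceSpace N M),
      -- the measure is regular, and represents the functional, for every choice of base points
      lam.Regular ∧
      (∀ (z : ∀ v : M, PlacesOver N v.1) (F : C_c(PlaceSpace N M, ℝ)),
        placeFunctional μ z F = ∫ y, F y ∂lam) ∧
      -- it is the only such measure
      (∀ lam' : Measure (PlaceSpace N M), lam'.Regular →
        ∀ z : ∀ v : M, PlacesOver N v.1,
        (∀ F : C_c(PlaceSpace N M, ℝ), placeFunctional μ z F = ∫ y, F y ∂lam') →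
        lam' = lam) ∧
      -- (i) invariance under the Galois group
      (∀ (η : Gal(N/K)) (F : PlaceSpace N M → ℝ), Integrable F lam →
        Integrable (fun y => F (η • y)) lam ∧
        ∀ v : M, ∫ y in PlaceSpace.fiber v, F (η • y) ∂lam
          = ∫ y in PlaceSpace.fiber v, F y ∂lam) ∧
      -- (ii) outer regularity
      (∀ E : Set (PlaceSpace N M), MeasurableSet E →
        lam E = ⨅ (U : Set (PlaceSpace N M)) (_ : E ⊆ U) (_ : IsOpen U), lam U) ∧
      -- (iii) inner regularity
      (∀ E : Set (PlaceSpace N M), MeasurableSet E →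
        {v : M | (E ∩ PlaceSpace.fiber v).Nonempty}.Countable →
        lam E = ⨆ (V : Set (PlaceSpace N M)) (_ : V ⊆ E) (_ : IsCompact V), lam V) ∧
      -- (iv) completeness
      (∀ E : Set (PlaceSpace N M), MeasurableSet E → lam E = 0 →
        ∀ S ⊆ E, MeasurableSet S) := by
  have hne (v : M) : Nonempty (PlacesOver N v.1) :=
    (hM.wellBehaved v v.2).nonempty_placesOver_of_isAlgebraic N
  refine ⟨hne, ?_⟩
  let z₀ : ∀ v : M, PlacesOver N v.1 := fun v => (hne v).some
  obtain ⟨𝒴, hle, lam, hreg, hrep, hinv, hinner, hcompl⟩ :=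
    exists_complete_rieszMeasure (placePositiveLinearMap μ z₀)
  have hrep' (z : ∀ v : M, PlacesOver N v.1) (F : C_c(PlaceSpace N M, ℝ)) :
      placeFunctional μ z F = ∫ y, F y ∂lam := by
    rw [hrep, placePositiveLinearMap_apply, placeFunctional_eq μ z z₀]
  refine ⟨𝒴, hle, lam, hreg, hrep', fun lam' hreg' z h => ?_, fun η F hF => ?_,
    fun E _ => E.measure_eq_iInf_isOpen lam, fun E hE hc => ?_,
    fun E _ hE0 S hS => hcompl S (measure_mono_null hS hE0)⟩
  · exact Measure.Regular.ext_of_integral_eq hle fun F => by rw [← h, hrep' z]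
  · obtain ⟨hpres, hemb⟩ := hinv (PlaceSpace.smulHomeomorph η)
      fun F F' hF' => placeFunctional_comp_smul μ z₀ F F' η hF'
    -- The action preserves the index `v`, so the preimage of a fibre is the same fibre
    -- definitionally.
    exact ⟨(hpres.integrable_comp_emb hemb).2 hF,
      fun v => hpres.setIntegral_preimage_emb hemb F (PlaceSpace.fiber v)⟩
  -- The countable cover consists of exactly those compact open fibres that `E` meets.
  · exact hinner E hE _ PlaceSpace.fiber PlaceSpace.isOpen_fiber PlaceSpace.isCompact_fiber _ hc
      fun y hy => Set.mem_iUnion₂.2 ⟨y.1, ⟨y, hy, rfl⟩, rfl⟩
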